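/- Let $k$ be a field. For a commutative $k$-algebra $A$ and a nonzerodivisor $f\in A$, let $\underline{P}HH(A,f)$ be the simplicial subring of the cyclic bar construction $HH(A[f^{-1}])=([n]\mapsto A[f^{-1}]^{\otimes_k(n+1)})$ whose ring of $n$-simplices consists of the sums of elements $a_0m_0\otimes\cdots\otimes a_nm_n$ with $a_i\in A$, $m_i\in A[f^{-1}]^{*}$ and $m_0\cdots m_n\in A$ (i.e. in the image of $A$); it is a simplicial $A$-algebra via $a\mapsto a\otimes1\otimes\cdots\otimes1$. Call $(A,f)$ a normal crossing modulus pair if $A$ is a smooth $k$-algebra, $f$ is a nonzerodivisor, and there is an étale covering $\operatorname{Spec}B\to\operatorname{Spec}A$ such that the support of the divisor of $f$ on $\operatorname{Spec} B$ has strict normal crossings, that is, for every prime $\mathfrak p\ni f$ of $B$ the local ring $B_{\mathfrak p}$ has a regular system of parameters $x_1,\dots,x_d$ with $\sqrt{fB_{\mathfrak p}}=(\prod_{i\in I}x_i)$ for some $I\subseteq\{1,\dots,d\}$. \textbf{Proposition (Zariski descent).} Let $(A,f)$ be a normal crossing modulus pair such that $f=f_1^{r_1}\cdots f_n^{r_n}$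 is a product of prime elements $f_i\in A$ (with $r_i\ge1$). Then for every multiplicatively closed subset $S\subset A$ the canonical map of simplicial commutative $S^{-1}A$-algebras \[ \underline{P}HH(A,f)\otimes_AS^{-1}A\longrightarrow\underline{P}HH(S^{-1}A,f) \] is an equivalence, i.e. it induces a quasi-isomorphism of the associated chain complexes of $S^{-1}A$-modules (with differential the alternating sum of the faces). -/

import Mathlib

open CategoryTheory TensorProduct

universe v u

/-! ### The simplicial circle and the cyclic bar construction -/

/-- The simplicial circle `Δ¹/∂Δ¹` has `{0, …, n}` as its set of `n`-simplices: `0` is the base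
point and `j ≥ 1` is the class of the map `[n] → [1]` whose fibre over `1` is `{j, …, n}`.
This is the map `S¹_n → S¹_m` induced by a monotone map `α : [m] → [n]`:
it sends `j` to the least `i` with `j ≤ α i`, and to the base point if there is none. -/
def simplicialCircleMap {m n : ℕ} (α : Fin (m + 1) →o Fin (n + 1)) (j : Fin (n + 1)) : Fin (m + 1) :=
  if h : (Finset.univ.filter fun i => j ≤ α i).Nonempty then
    (Finset.univ.filter fun i => j ≤ α i).min' h
  else 0

theorem simplicialCircleMap_of_exists {m n : ℕ} (α : Fin (m + 1) →o Fin (n + 1)) (j : Fin (n + 1))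
    (h : ∃ i, j ≤ α i) (i : Fin (m + 1)) : simplicialCircleMap α j ≤ i ↔ j ≤ α i := by
  have h' : (Finset.univ.filter fun i => j ≤ α i).Nonempty := by
    obtain ⟨i, hi⟩ := h
    exact ⟨i, by simpa using hi⟩
  have hm := Finset.min'_mem _ h'
  rw [simplicialCircleMap, dif_pos h']
  constructor
  · intro hi
    exact (Finset.mem_filter.mp hm).2.trans (α.monotone hi)
  · intro hi
    exact Finset.min'_le _ _ (by simpa using hi)

theorem simplicialCircleMap_of_not_exists {m n : ℕ} (α : Fin (m + 1) →o Fin (n + 1)) (j : Fin (n + 1))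
    (h : ¬ ∃ i, j ≤ α i) : simplicialCircleMap α j = 0 := by
  rw [simplicialCircleMap, dif_neg]
  rintro ⟨i, hi⟩
  exact h ⟨i, by simpa using hi⟩

@[simp] theorem simplicialCircleMap_zero {m n : ℕ} (α : Fin (m + 1) →o Fin (n + 1)) :
    simplicialCircleMap α 0 = 0 := by
  have := (simplicialCircleMap_of_exists α 0 ⟨0, Fin.zero_le _⟩ 0).2 (Fin.zero_le _)
  exact le_antisymm this (Fin.zero_le _)

theorem simplicialCircleMap_id {n : ℕ} (j : Fin (n + 1)) : simplicialCircleMap OrderHom.id j = j :=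
  eq_of_forall_ge_iff fun i => simplicialCircleMap_of_exists OrderHom.id j ⟨j, le_rfl⟩ i

theorem simplicialCircleMap_comp {l m n : ℕ} (α : Fin (m + 1) →o Fin (n + 1))
    (β : Fin (l + 1) →o Fin (m + 1)) (j : Fin (n + 1)) :
    simplicialCircleMap (α.comp β) j = simplicialCircleMap β (simplicialCircleMap α j) := by
  by_cases h : ∃ i, j ≤ α i
  · by_cases h' : ∃ i, j ≤ α (β i)
    · refine eq_of_forall_ge_iff fun i => ?_
      rw [simplicialCircleMap_of_exists (α.comp β) j h', simplicialCircleMap_of_exists β, simplicialCircleMap_of_exists α j h]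
      · rfl
      · obtain ⟨i, hi⟩ := h'
        exact ⟨i, (simplicialCircleMap_of_exists α j h _).2 hi⟩
    · rw [simplicialCircleMap_of_not_exists (α.comp β) j h', simplicialCircleMap_of_not_exists β]
      rintro ⟨i, hi⟩
      exact h' ⟨i, (simplicialCircleMap_of_exists α j h _).1 hi⟩
  · rw [simplicialCircleMap_of_not_exists α j h, simplicialCircleMap_zero, simplicialCircleMap_of_not_exists]
    rintro ⟨i, hi⟩
    exact h ⟨_, hi⟩

noncomputable section

/-- `⨂ᵢ cᵢ ↦ ⨂ⱼ (∏_{g i = j} φ (cᵢ))`, for a map `g` of finite index sets and a homomorphism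
`φ` of commutative `k`-algebras (see `tensorMap_tprod`). -/
def tensorMap {k : Type*} [CommRing k] {ι κ : Type*} [Fintype ι] [DecidableEq κ]
    {C D : Type*} [CommRing C] [Algebra k C] [CommRing D] [Algebra k D]
    (g : ι → κ) (φ : C →ₐ[k] D) : (⨂[k] _ : ι, C) →ₐ[k] ⨂[k] _ : κ, D :=
  PiTensorProduct.liftAlgHom
    ((MultilinearMap.mkPiAlgebra k ι (⨂[k] _ : κ, D)).compLinearMap fun i =>
      ((PiTensorProduct.singleAlgHom (R := k) (A := fun _ : κ => D) (g i)).comp φ).toLinearMap)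
    (by simp only [MultilinearMap.compLinearMap_apply, MultilinearMap.mkPiAlgebra_apply,
          AlgHom.toLinearMap_apply, Pi.one_apply, map_one, Finset.prod_const_one])
    (by
      intro x y
      simp only [MultilinearMap.compLinearMap_apply, MultilinearMap.mkPiAlgebra_apply,
        AlgHom.toLinearMap_apply, Pi.mul_apply, map_mul, Finset.prod_mul_distrib])

theorem tensorMap_tprod {k : Type*} [CommRing k] {ι κ : Type*} [Fintype ι] [DecidableEq κ]
    {C D : Type*} [CommRing C] [Algebra k C] [CommRing D] [Algebra k D]
    (g : ι → κ) (φ : C →ₐ[k] D) (c : ι → C) :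
    tensorMap g φ (PiTensorProduct.tprod k c) =
      PiTensorProduct.tprod k fun j => ∏ i with g i = j, φ (c i) := by
  have h : tensorMap g φ (PiTensorProduct.tprod k c) =
      ∏ i, PiTensorProduct.tprod k (Pi.mulSingle (M := fun _ : κ => D) (g i) (φ (c i))) := by
    simp [tensorMap]
  rw [h, ← PiTensorProduct.tprod_prod]
  congr 1
  ext j
  rw [Finset.prod_apply, Finset.prod_filter]
  refine Finset.prod_congr rfl fun i _ => ?_
  rw [Pi.mulSingle_apply]
  simp only [eq_comm]

/-! ### The replete sub-simplicial ring -/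

/-- The elements `a₀m₀ ⊗ ⋯ ⊗ aₙmₙ` of `C^{⊗ (n+1)}` with `aᵢ ∈ A`, `mᵢ ∈ Cˣ` and
`m₀ ⋯ mₙ ∈ A` (that is, in the image of `A → C`). They are closed under multiplication. -/
def repleteTensors (k A C : Type*) [CommRing k] [CommRing A] [CommRing C] [Algebra k C]
    [Algebra A C] (n : ℕ) : Submonoid (⨂[k] _ : Fin (n + 1), C) where
  carrier := {x | ∃ (a : Fin (n + 1) → A) (m : Fin (n + 1) → Cˣ),
    (∃ b : A, algebraMap A C b = ∏ i, (m i : C)) ∧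
      x = PiTensorProduct.tprod k fun i => algebraMap A C (a i) * (m i : C)}
  one_mem' := ⟨1, 1, ⟨1, by simp⟩, by
    rw [PiTensorProduct.one_def]; congr 1; ext; simp⟩
  mul_mem' := by
    rintro _ _ ⟨a, m, ⟨b, hb⟩, rfl⟩ ⟨a', m', ⟨b', hb'⟩, rfl⟩
    refine ⟨a * a', m * m', ⟨b * b', ?_⟩, ?_⟩
    · simp [hb, hb', Finset.prod_mul_distrib]
    · rw [PiTensorProduct.tprod_mul_tprod]
      congr 1
      ext i
      simp only [Pi.mul_apply, map_mul, Units.val_mul]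
      ring

/-- The ring of sums of elements `a₀m₀ ⊗ ⋯ ⊗ aₙmₙ` of `C^{⊗ (n+1)}` with `aᵢ ∈ A`, `mᵢ ∈ Cˣ`
and `m₀ ⋯ mₙ ∈ A`. -/
def repleteSubalgebra (k A C : Type*) [CommRing k] [CommRing A] [CommRing C] [Algebra k A]
    [Algebra k C] [Algebra A C] [IsScalarTower k A C] (n : ℕ) :
    Subalgebra k (⨂[k] _ : Fin (n + 1), C) where
  toSubsemiring := (repleteTensors k A C n).subsemiringClosure
  algebraMap_mem' r := by
    refine AddSubmonoid.subset_closure ⟨Pi.mulSingle 0 (algebraMap k A r), 1, ⟨1, by simp⟩, ?_⟩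
    rw [PiTensorProduct.algebraMap_apply (i := 0)]
    congr 1
    ext i
    by_cases hi : i = 0
    · subst hi
      simp [← IsScalarTower.algebraMap_apply]
    · simp [hi]

theorem tensorMap_mem_repleteSubalgebra {k A B C D : Type*} [CommRing k]
    [CommRing A] [CommRing B] [CommRing C] [CommRing D]
    [Algebra k A] [Algebra k B] [Algebra k C] [Algebra k D]
    [Algebra A C] [Algebra B D] [IsScalarTower k A C] [IsScalarTower k B D]
    {m n : ℕ} (g : Fin (n + 1) → Fin (m + 1)) (φ : C →ₐ[k] D) (ψ : A →+* B)
    (h : ∀ a, φ (algebraMap A C a) = algebraMap B D (ψ a)) (x : ⨂[k] _ : Fin (n + 1), C)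
    (hx : x ∈ repleteSubalgebra k A C n) : tensorMap g φ x ∈ repleteSubalgebra k B D m := by
  change x ∈ AddSubmonoid.closure _ at hx
  induction hx using AddSubmonoid.closure_induction with
  | zero => rw [map_zero]; exact zero_mem _
  | add x y _ _ hx hy => rw [map_add]; exact add_mem hx hy
  | mem x hx =>
    obtain ⟨a, u, ⟨b, hb⟩, rfl⟩ := hx
    refine AddSubmonoid.subset_closure
      ⟨fun j => ∏ i with g i = j, ψ (a i),
        fun j => ∏ i with g i = j, Units.map (φ : C →* D) (u i), ⟨ψ b, ?_⟩, ?_⟩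
    · simp only [Units.coe_prod, Units.coe_map]
      rw [← h, hb, map_prod, Finset.prod_fiberwise]
      rfl
    · rw [tensorMap_tprod]
      congr 1
      ext j
      simp only [Units.coe_prod, Units.coe_map, map_mul, Finset.prod_mul_distrib, map_prod, h]
      rfl

/-! ### `PHH (A, f)` -/

section PHH

variable (k : Type v) [CommRing k] (A : Type u) [CommRing A] [Algebra k A] (f : A)

/-- The ring of `n`-simplices of `PHH (A, f)`: the ring of sums of elements
`a₀m₀ ⊗ ⋯ ⊗ aₙmₙ` of `A[f⁻¹]^{⊗ (n+1)}` with `aᵢ ∈ A`, `mᵢ ∈ A[f⁻¹]ˣ` and `m₀ ⋯ mₙ ∈ A`. -/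
def PHHRing (n : ℕ) : Type (max v u) :=
  ↥(repleteSubalgebra k A (Localization.Away f) n)

instance (n : ℕ) : CommRing (PHHRing k A f n) :=
  inferInstanceAs (CommRing ↥(repleteSubalgebra k A (Localization.Away f) n))

/-- The structure map `A → PHH (A, f)ₙ`, `a ↦ a ⊗ 1 ⊗ ⋯ ⊗ 1`. -/
def PHHRing.ofBase (n : ℕ) : A →+* PHHRing k A f n :=
  (((PiTensorProduct.singleAlgHom (R := k) (A := fun _ : Fin (n + 1) => Localization.Away f)
      0).toRingHom).comp (algebraMap A (Localization.Away f))).codRestrict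
    (repleteSubalgebra k A (Localization.Away f) n) fun a =>
      AddSubmonoid.subset_closure ⟨Pi.mulSingle 0 a, 1, ⟨1, by simp⟩, by
        change PiTensorProduct.tprod k _ = _
        congr 1
        ext i
        by_cases hi : i = 0
        · subst hi
          simp
        · simp [hi]⟩

instance (n : ℕ) : Algebra A (PHHRing k A f n) := (PHHRing.ofBase k A f n).toAlgebra

variable {A} in
/-- The map `⨂ᵢ cᵢ ↦ ⨂ⱼ (∏_{g i = j} cᵢ)` on `PHH (A, f)`, for a base point preserving `g`. -/
def PHHRing.simplicialMap {m n : ℕ} (g : Fin (n + 1) → Fin (m + 1)) (hg : g 0 = 0) :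
    PHHRing k A f n →ₐ[A] PHHRing k A f m where
  toRingHom := (tensorMap (k := k) g (AlgHom.id k (Localization.Away f))).toRingHom.restrict
    (repleteSubalgebra k A (Localization.Away f) n)
    (repleteSubalgebra k A (Localization.Away f) m)
    (tensorMap_mem_repleteSubalgebra g _ (RingHom.id A) fun _ => rfl)
  commutes' a := by
    refine Subtype.ext ?_
    change tensorMap (k := k) g (AlgHom.id k (Localization.Away f))
      (PiTensorProduct.tprod k (Pi.mulSingle 0 (algebraMap A _ a))) =
      PiTensorProduct.tprod k (Pi.mulSingle 0 (algebraMap A _ a))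
    rw [tensorMap_tprod]
    congr 1
    ext j
    by_cases hj : j = 0
    · subst hj
      rw [Pi.mulSingle_eq_same, Finset.prod_eq_single 0]
      · simp
      · intro i _ hi
        simp [hi]
      · simp [hg]
    · rw [Pi.mulSingle_eq_of_ne hj]
      refine Finset.prod_eq_one fun i hi => ?_
      have : i ≠ 0 := by
        rintro rfl
        exact hj ((Finset.mem_filter.mp hi).2.symm.trans hg)
      simp [this]

variable {A} in
@[simp] theorem PHHRing.simplicialMap_val {m n : ℕ} (g : Fin (n + 1) → Fin (m + 1)) (hg : g 0 = 0)
    (x : PHHRing k A f n) : (PHHRing.simplicialMap k f g hg x).1 =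
      tensorMap (k := k) g (AlgHom.id k (Localization.Away f)) x.1 := rfl

theorem tensorMap_id {k : Type*} [CommRing k] {ι : Type*} [Fintype ι] [DecidableEq ι]
    {C : Type*} [CommRing C] [Algebra k C] (x : ⨂[k] _ : ι, C) :
    tensorMap (k := k) (id : ι → ι) (AlgHom.id k C) x = x := by
  induction x using PiTensorProduct.induction_on with
  | smul_tprod r c =>
    rw [map_smul, tensorMap_tprod]
    congr 2
    ext j
    simp [Finset.filter_eq']
  | add x y hx hy => rw [map_add, hx, hy]

theorem tensorMap_comp {k : Type*} [CommRing k] {ι κ l : Type*} [Fintype ι] [Fintype κ]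
    [DecidableEq κ] [DecidableEq l] {C D E : Type*} [CommRing C] [Algebra k C] [CommRing D]
    [Algebra k D] [CommRing E] [Algebra k E] (g : ι → κ) (φ : C →ₐ[k] D) (h : κ → l)
    (χ : D →ₐ[k] E) (x : ⨂[k] _ : ι, C) :
    tensorMap h χ (tensorMap g φ x) = tensorMap (h ∘ g) (χ.comp φ) x := by
  induction x using PiTensorProduct.induction_on with
  | smul_tprod r c =>
    simp only [map_smul, tensorMap_tprod]
    congr 2
    ext j
    simp only [map_prod, AlgHom.comp_apply, Function.comp_apply]
    rw [← Finset.prod_fiberwise_of_maps_to (s := {i | h (g i) = j}) (t := {x | h x = j}) (g := g)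
      (by simp)]
    refine Finset.prod_congr rfl fun y hy => Finset.prod_congr ?_ fun _ _ => rfl
    ext i
    simp only [Finset.mem_filter, Finset.mem_univ, true_and] at hy ⊢
    exact ⟨fun e => ⟨e ▸ hy, e⟩, And.right⟩
  | add x y hx hy => simp only [map_add, hx, hy]

/-- The simplicial commutative `A`-algebra `PHH (A, f)`: the simplicial subring of the cyclic bar
construction `[n] ↦ A[f⁻¹]^{⊗ (n+1)}` (tensor products over `k`) with `n`-simplices
`PHHRing k A f n`. A monotone map `α : [m] → [n]` acts by multiplying together the factors which
have the same image in the simplicial circle. -/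
def PHH : SimplicialObject (CommAlgCat.{max v u} A) where
  obj n := CommAlgCat.of A (PHHRing k A f n.unop.len)
  map α := CommAlgCat.ofHom (PHHRing.simplicialMap k f
    (simplicialCircleMap α.unop.toOrderHom) (simplicialCircleMap_zero _))
  map_id n := by
    ext x
    refine Subtype.ext ?_
    change tensorMap (k := k) (simplicialCircleMap OrderHom.id) (AlgHom.id k _) x.1 = x.1
    rw [show simplicialCircleMap OrderHom.id = id from funext simplicialCircleMap_id,
      tensorMap_id]
  map_comp α β := by
    ext x
    refine Subtype.ext ?_
    change tensorMap (k := k) (simplicialCircleMap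
      (α.unop.toOrderHom.comp β.unop.toOrderHom)) (AlgHom.id k _) x.1 =
      tensorMap (k := k) (simplicialCircleMap β.unop.toOrderHom) (AlgHom.id k _)
        (tensorMap (k := k) (simplicialCircleMap α.unop.toOrderHom) (AlgHom.id k _) x.1)
    rw [tensorMap_comp, funext (simplicialCircleMap_comp α.unop.toOrderHom β.unop.toOrderHom)]
    rfl

/-! ### Base change -/

/-- The simplicial commutative `B`-algebra `PHH (A, f) ⊗_A B`, for an `A`-algebra `B`. -/
def PHHBaseChange (B : Type u) [CommRing B] [Algebra A B] :
    SimplicialObject (CommAlgCat.{max v u} B) where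
  obj n := CommAlgCat.of B (B ⊗[A] (PHH k A f).obj n)
  map α := CommAlgCat.ofHom
    (Algebra.TensorProduct.map (AlgHom.id B B) ((PHH k A f).map α).hom)
  map_id n := by
    rw [CategoryTheory.Functor.map_id]
    ext : 1
    exact Algebra.TensorProduct.map_id
  map_comp α β := by
    rw [CategoryTheory.Functor.map_comp]
    ext x
    simp

variable (B : Type u) [CommRing B] [Algebra k B] [Algebra A B] [IsScalarTower k A B]

/-- The homomorphism `A[f⁻¹] → B[f⁻¹]` of `k`-algebras induced by `A → B`. -/
def awayBaseChange :
    Localization.Away f →ₐ[k] Localization.Away (algebraMap A B f) :=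
  { Localization.awayMap (algebraMap A B) f with
    commutes' := fun r => by
      change Localization.awayMap (algebraMap A B) f _ = _
      rw [IsScalarTower.algebraMap_apply k A (Localization.Away f), Localization.awayMap,
        IsLocalization.Away.map, IsLocalization.map_eq, ← IsScalarTower.algebraMap_apply k A B,
        ← IsScalarTower.algebraMap_apply k B] }

theorem awayBaseChange_algebraMap (a : A) :
    awayBaseChange k A f B (algebraMap A _ a) = algebraMap B _ (algebraMap A B a) :=
  IsLocalization.map_eq (M := Submonoid.powers f) (S := Localization.Away f)
    (T := Submonoid.powers (algebraMap A B f)) (Q := Localization.Away (algebraMap A B f))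
    (g := algebraMap A B) (by
      rintro _ ⟨n, rfl⟩
      exact ⟨n, by simp⟩) a

/-- The map `PHH (A, f)ₙ → PHH (B, f)ₙ` induced by `A → B`:
it is `⨂ᵢ cᵢ ↦ ⨂ᵢ cᵢ`, with `cᵢ ∈ A[f⁻¹]` sent to its image in `B[f⁻¹]`. -/
def PHHRing.map (n : ℕ) : PHHRing k A f n →+* PHHRing k B (algebraMap A B f) n :=
  (tensorMap (k := k) id (awayBaseChange k A f B)).toRingHom.restrict
    (repleteSubalgebra k A (Localization.Away f) n)
    (repleteSubalgebra k B (Localization.Away (algebraMap A B f)) n)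
    (tensorMap_mem_repleteSubalgebra id _ (algebraMap A B) (awayBaseChange_algebraMap k A f B))

theorem PHHRing.map_algebraMap (n : ℕ) (a : A) :
    PHHRing.map k A f B n (algebraMap A _ a) = algebraMap B _ (algebraMap A B a) := by
  refine Subtype.ext ?_
  change tensorMap (k := k) id (awayBaseChange k A f B)
    (PiTensorProduct.tprod k (Pi.mulSingle 0 (algebraMap A _ a))) =
    PiTensorProduct.tprod k (Pi.mulSingle 0 (algebraMap B _ (algebraMap A B a)))
  rw [tensorMap_tprod]
  congr 1
  ext j
  simp only [id, Finset.filter_eq', Finset.mem_univ, if_true, Finset.prod_singleton]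
  by_cases hj : j = 0
  · subst hj
    simp [awayBaseChange_algebraMap]
  · simp [hj]

/-- The canonical map `PHH (A, f)ₙ ⊗_A B → PHH (B, f)ₙ` of `B`-algebras. -/
def PHHRing.comparison (n : ℕ) :
    B ⊗[A] PHHRing k A f n →ₐ[B] PHHRing k B (algebraMap A B f) n :=
  letI : Algebra A (PHHRing k B (algebraMap A B f) n) :=
    ((algebraMap B (PHHRing k B (algebraMap A B f) n)).comp (algebraMap A B)).toAlgebra
  haveI : IsScalarTower A B (PHHRing k B (algebraMap A B f) n) := .of_algebraMap_eq fun _ => rfl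
  Algebra.TensorProduct.lift (Algebra.ofId B _)
    { PHHRing.map k A f B n with commutes' := PHHRing.map_algebraMap k A f B n }
    fun _ _ => Commute.all _ _

theorem PHHRing.comparison_tmul (n : ℕ) (b : B) (x : PHHRing k A f n) :
    PHHRing.comparison k A f B n (b ⊗ₜ x) = algebraMap B _ b * PHHRing.map k A f B n x := rfl

/-- The canonical map `PHH (A, f) ⊗_A B → PHH (B, f)` of simplicial commutative `B`-algebras. -/
def PHHComparison : PHHBaseChange k A f B ⟶ PHH k B (algebraMap A B f) where
  app n := CommAlgCat.ofHom (PHHRing.comparison k A f B n.unop.len)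
  naturality m n α := by
    refine CommAlgCat.hom_ext (AlgHom.ext ?_)
    let σ := simplicialCircleMap α.unop.toOrderHom
    have hσ : σ 0 = 0 := simplicialCircleMap_zero _
    change ∀ t : B ⊗[A] PHHRing k A f m.unop.len,
      PHHRing.comparison k A f B _
          (Algebra.TensorProduct.map (AlgHom.id B B) (PHHRing.simplicialMap k f σ hσ) t) =
        PHHRing.simplicialMap k (algebraMap A B f) σ hσ (PHHRing.comparison k A f B _ t)
    intro t
    induction t using TensorProduct.induction_on with
    | zero => simp only [map_zero]
    | add x y hx hy => simp only [map_add, hx, hy]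
    | tmul b x => ?_
    rw [Algebra.TensorProduct.map_tmul, PHHRing.comparison_tmul, PHHRing.comparison_tmul,
      map_mul, AlgHom.commutes, AlgHom.id_apply]
    congr 1
    refine Subtype.ext ?_
    change tensorMap (k := k) id (awayBaseChange k A f B)
        (tensorMap (k := k) _ (AlgHom.id k _) x.1) =
      tensorMap (k := k) _ (AlgHom.id k _)
        (tensorMap (k := k) id (awayBaseChange k A f B) x.1)
    rw [tensorMap_comp, tensorMap_comp]
    rfl

/-- The chain complex of `R`-modules underlying a simplicial commutative `R`-algebra, with the
alternating sum of the faces as its differential. -/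
def simplicialAlgebraComplex (R : Type u) [CommRing R] :
    SimplicialObject (CommAlgCat.{max v u} R) ⥤ ChainComplex (ModuleCat.{max v u} R) ℕ :=
  (SimplicialObject.whiskering _ _).obj
      (forget₂ (CommAlgCat.{max v u} R) (AlgCat.{max v u} R) ⋙
        forget₂ (AlgCat.{max v u} R) (ModuleCat.{max v u} R)) ⋙
    AlgebraicTopology.alternatingFaceMapComplex (ModuleCat.{max v u} R)

end PHH

end

/-! ### Normal crossing modulus pairs -/

/-- A regular system of parameters of a Noetherian local ring: a minimal possible number
`dim R` of generators of the maximal ideal. -/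
def IsRegularSystemOfParameters (R : Type*) [CommRing R] [IsLocalRing R] {d : ℕ}
    (x : Fin d → R) : Prop :=
  Ideal.span (Set.range x) = IsLocalRing.maximalIdeal R ∧ ringKrullDim R = d

/-- The support of the divisor of `f` on `Spec B` is a strict normal crossing divisor: at every
point of the support, the local ring has a regular system of parameters such that the reduced
divisor is cut out by the product of some of the parameters. -/
def HasStrictNormalCrossings (B : Type*) [CommRing B] (f : B) : Prop :=
  IsNoetherianRing B ∧ ∀ (p : Ideal B) [p.IsPrime], f ∈ p →
    ∃ (d : ℕ) (x : Fin d → Localization.AtPrime p) (I : Finset (Fin d)),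
      IsRegularSystemOfParameters (Localization.AtPrime p) x ∧
      (Ideal.span {algebraMap B (Localization.AtPrime p) f}).radical =
        Ideal.span {∏ i ∈ I, x i}

/-- `(Spec A, (f))` is a normal crossing modulus pair over `k`: `A` is a smooth `k`-algebra, `f` is
a nonzerodivisor, and the support of the divisor of `f` is a strict normal crossing divisor after
pullback along an étale covering `Spec B → Spec A`. -/
structure IsNormalCrossingModulusPair (k : Type v) (A : Type u) [Field k] [CommRing A]
    [Algebra k A] (f : A) : Prop where
  smooth : Algebra.Smooth k A
  mem_nonZeroDivisors : f ∈ nonZeroDivisors A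
  exists_etale_covering : ∃ (B : Type u) (_ : CommRing B) (_ : Algebra A B),
    Algebra.Etale A B ∧ Function.Surjective (PrimeSpectrum.comap (algebraMap A B)) ∧
      HasStrictNormalCrossings B (algebraMap A B f)

/-! The comparison map is not an isomorphism in each degree: its source inverts `S` only in tensor
factor 0, its target in all factors. It is, however, a localization at the tensors `s ⊗ ⋯ ⊗ s` in
each degree: such a tensor kills any given kernel element (`PHHRing.exists_comparison_eq_zero`) and
moves any given element of the target into the image (`PHHRing.exists_pureTensor_mul_eq_map`).

On homology these tensors already act invertibly. If all faces of `z` vanish, multiplying `z` by `t`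
in slot `i` or in slot `i + 1` gives homologous results, so `t` may be moved to slot 0, where it is
a scalar from `S`, a unit of `B` (`CyclicBarAction.act_sub_smul_mem`). Clearing denominators
therefore changes a class only by a unit, and `CyclicBarAction.quasiIso` follows.

Prime factors enter in the surjectivity up to denominators: they make every unit of `B[f⁻¹]` a unit
of `B` times a unit of `A[f⁻¹]`, so that the condition on the product of the units descends from `B`
to `A` (`exists_smul_mul_unit_eq`). -/

/-! ### Quasi-isomorphisms tested on cycles -/

namespace CategoryTheory.ShortComplex

/-- A morphism of short complexes of modules is a quasi-isomorphism as soon as it is surjective and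
injective on homology classes. -/
theorem moduleCat_quasiIso {R : Type*} [Ring R] {S₁ S₂ : ShortComplex (ModuleCat.{v} R)}
    (φ : S₁ ⟶ S₂)
    (surj : ∀ z : S₂.X₂, S₂.g z = 0 → ∃ y : S₁.X₂, S₁.g y = 0 ∧ ∃ w, φ.τ₂ y - z = S₂.f w)
    (inj : ∀ y : S₁.X₂, S₁.g y = 0 → ∀ w, φ.τ₂ y = S₂.f w → ∃ x, y = S₁.f x) :
    QuasiIso φ := by
  let h₁ := S₁.moduleCatLeftHomologyData
  let h₂ := S₂.moduleCatLeftHomologyData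
  let γ : LeftHomologyMapData φ h₁ h₂ := default
  have hK (y : h₁.K) : h₂.i (γ.φK y) = φ.τ₂ (h₁.i y) := ConcreteCategory.congr_hom γ.commi y
  have hH (y : h₁.K) : γ.φH (h₁.π y) = h₂.π (γ.φK y) := ConcreteCategory.congr_hom γ.commπ y
  rw [γ.quasiIso_iff, ConcreteCategory.isIso_iff_bijective]
  constructor
  · refine (injective_iff_map_eq_zero γ.φH.hom).2 fun a ha => ?_
    obtain ⟨y, rfl⟩ : ∃ y, h₁.π y = a := Submodule.mkQ_surjective _ a
    replace ha : h₂.π (γ.φK y) = 0 := (hH y).symm.trans ha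
    obtain ⟨w, hw⟩ := (Submodule.Quotient.mk_eq_zero _).1 ha
    obtain ⟨x, hx⟩ := inj (h₁.i y) (Subtype.prop (p := (· ∈ LinearMap.ker S₁.g.hom)) y) w
      ((hK y).symm.trans (congrArg h₂.i hw.symm))
    exact (Submodule.Quotient.mk_eq_zero _).2 ⟨x, Subtype.ext hx.symm⟩
  · intro b
    obtain ⟨z, rfl⟩ : ∃ z, h₂.π z = b := Submodule.mkQ_surjective _ b
    obtain ⟨y, hy, w, hw⟩ := surj (h₂.i z) (Subtype.prop (p := (· ∈ LinearMap.ker S₂.g.hom)) z)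
    let y' : h₁.K := (⟨y, hy⟩ : LinearMap.ker S₁.g.hom)
    refine ⟨h₁.π y', (hH y').trans ?_⟩
    refine (Submodule.Quotient.eq _).2 ⟨w, Subtype.ext ?_⟩
    exact hw.symm.trans (congrArg (· - h₂.i z) (hK y').symm)

end CategoryTheory.ShortComplex

namespace ChainComplex

/-- Cycles are required to die under `d n m` for all `m`, so that degree 0 needs no separate case.
-/
theorem moduleCat_quasiIso {R : Type*} [Ring R] {K L : ChainComplex (ModuleCat.{v} R) ℕ}
    (φ : K ⟶ L)
    (surj : ∀ n (z : L.X n), (∀ m, L.d n m z = 0) →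
      ∃ y : K.X n, (∀ m, K.d n m y = 0) ∧ ∃ w, φ.f n y - z = L.d (n + 1) n w)
    (inj : ∀ n (y : K.X n), (∀ m, K.d n m y = 0) → ∀ w, φ.f n y = L.d (n + 1) n w →
      ∃ x, y = K.d (n + 1) n x) :
    QuasiIso φ := by
  have hd {M : ChainComplex (ModuleCat.{v} R) ℕ} (n : ℕ) (z : M.X n)
      (hz : M.d n ((ComplexShape.down ℕ).next n) z = 0) (m : ℕ) : M.d n m z = 0 := by
    by_cases h : (ComplexShape.down ℕ).Rel n m
    · obtain rfl := (ComplexShape.down ℕ).next_eq' h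
      exact hz
    · rw [M.shape _ _ h]; rfl
  rw [quasiIso_iff]
  intro n
  rw [quasiIsoAt_iff]
  have hn : (ComplexShape.down ℕ).prev n = n + 1 := ChainComplex.prev ℕ n
  refine ShortComplex.moduleCat_quasiIso _ (fun (z : L.X n) hz => ?_) (fun (y : K.X n) hy => ?_)
  · obtain ⟨y, hy, hw⟩ := surj n z (hd n z hz)
    refine ⟨y, hy _, (?_ : ∃ w, φ.f n y - z = L.d ((ComplexShape.down ℕ).prev n) n w)⟩
    rwa [hn]
  · change ∀ w : L.X ((ComplexShape.down ℕ).prev n), φ.f n y = L.d _ n w →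
      ∃ x, y = K.d ((ComplexShape.down ℕ).prev n) n x
    rw [hn]
    exact inj n y (hd n y hy)

end ChainComplex

/-! ### Normalized chains -/

namespace AlgebraicTopology

open Simplicial AlgebraicTopology.DoldKan Opposite

variable {R : Type*} [Ring R] (X : SimplicialObject (ModuleCat.{v} R))

/-- The differential of the alternating face map complex. -/
noncomputable def faceSum (n : ℕ) : X _⦋n + 1⦌ →ₗ[R] X _⦋n⦌ :=
  ∑ i : Fin (n + 2), (-1 : ℤ) ^ (i : ℕ) • (X.δ i).hom

theorem alternatingFaceMapComplex_d_apply (n : ℕ) (x : X _⦋n + 1⦌) :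
    ((alternatingFaceMapComplex _).obj X).d (n + 1) n x = faceSum X n x := by
  rw [alternatingFaceMapComplex_obj_d, faceSum]
  simp [AlternatingFaceMapComplex.objD]

theorem faceSum_apply (n : ℕ) (x : X _⦋n + 1⦌) :
    faceSum X n x = ∑ i : Fin (n + 2), (-1 : ℤ) ^ (i : ℕ) • X.δ i x := by
  simp [faceSum]

/-- All the faces of an `n`-simplex vanish. -/
def FacesVanish {n : ℕ} (x : X _⦋n⦌) : Prop :=
  match n, x with
  | 0, _ => True
  | _ + 1, x => ∀ i, X.δ i x = 0

/-- The projection onto the normalized chains. -/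
noncomputable def normalize (n : ℕ) : X _⦋n⦌ →ₗ[R] X _⦋n⦌ :=
  (PInfty.f n : X _⦋n⦌ ⟶ X _⦋n⦌).hom

theorem δ_succ_normalize (n : ℕ) (x : X _⦋n + 1⦌) (i : Fin (n + 1)) :
    X.δ i.succ (normalize X (n + 1) x) = 0 :=
  ConcreteCategory.congr_hom ((HigherFacesVanish.of_P (n + 1) n) i (by omega)) x

theorem faceSum_eq_of_higher (n : ℕ) (x : X _⦋n + 1⦌) (h : ∀ i : Fin (n + 1), X.δ i.succ x = 0) :
    faceSum X n x = X.δ 0 x := by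
  rw [faceSum_apply, Fin.sum_univ_succ]
  simp [h]

theorem faceSum_normalize (n : ℕ) (x : X _⦋n + 1⦌) :
    faceSum X n (normalize X (n + 1) x) = normalize X n (faceSum X n x) := by
  have := ConcreteCategory.congr_hom ((PInfty (X := X)).comm (n + 1) n) x
  rw [← alternatingFaceMapComplex_d_apply, ← alternatingFaceMapComplex_d_apply]
  exact this

theorem normalize_naturality {X Y : SimplicialObject (ModuleCat.{v} R)} (φ : X ⟶ Y) (n : ℕ)
    (x : X _⦋n⦌) : normalize Y n (φ.app (op ⦋n⦌) x) = φ.app (op ⦋n⦌) (normalize X n x) :=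
  ConcreteCategory.congr_hom (PInfty_f_naturality n φ) x

/-- The projection `PInfty` kills the faces of positive index, so the differential of a normalized
chain is its face 0; for a cycle this vanishes too. -/
theorem facesVanish_normalize {n : ℕ} (x : X _⦋n⦌)
    (hx : ∀ m, ((alternatingFaceMapComplex _).obj X).d n m x = 0) :
    FacesVanish X (normalize X n x) := by
  cases n with
  | zero => trivial
  | succ n =>
    intro i
    cases i using Fin.cases with
    | succ i => exact δ_succ_normalize X n x i
    | zero =>
      rw [← faceSum_eq_of_higher _ _ _ (δ_succ_normalize X n x), faceSum_normalize,
        ← alternatingFaceMapComplex_d_apply, hx, map_zero]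

theorem d_eq_zero_of_facesVanish {n : ℕ} (x : X _⦋n⦌) (hx : FacesVanish X x) (m : ℕ) :
    ((alternatingFaceMapComplex _).obj X).d n m x = 0 := by
  by_cases h : (ComplexShape.down ℕ).Rel n m
  · obtain rfl : m + 1 = n := h
    rw [alternatingFaceMapComplex_d_apply, faceSum_apply]
    exact Finset.sum_eq_zero fun i _ => by rw [hx i, smul_zero]
  · rw [HomologicalComplex.shape _ _ _ h]; rfl

theorem normalize_sub_mem_range {n : ℕ} (x : X _⦋n⦌)
    (hx : ∀ m, ((alternatingFaceMapComplex _).obj X).d n m x = 0) :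
    normalize X n x - x ∈ LinearMap.range (faceSum X n) := by
  have h := (homotopyPInftyToId X).comm n
  rw [Homotopy.prevD_chainComplex, dNext_nat] at h
  have h' := ConcreteCategory.congr_hom h x
  -- For `n = 0` the index `n - 1` is again 0; `hx` covers this case since it holds for every target
  -- degree.
  have h₀ : (homotopyPInftyToId X).hom (n - 1) n
      (((alternatingFaceMapComplex _).obj X).d n (n - 1) x) = 0 := by rw [hx, map_zero]
  refine ⟨(homotopyPInftyToId X).hom n (n + 1) x, ?_⟩
  rw [← alternatingFaceMapComplex_d_apply]
  refine (sub_eq_of_eq_add ?_).symm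
  refine h'.trans ?_
  let v : X _⦋n⦌ := ((alternatingFaceMapComplex _).obj X).d (n + 1) n
    ((homotopyPInftyToId X).hom n (n + 1) x)
  let u : X _⦋n⦌ := (homotopyPInftyToId X).hom (n - 1) n
    (((alternatingFaceMapComplex _).obj X).d n (n - 1) x)
  change u + v + x = v + x
  rw [show u = 0 from h₀, zero_add]

end AlgebraicTopology

/-! ### Actions of the cyclic bar construction, up to homotopy -/

/-- For a coface `α` this makes the induced map of circles surjective, with `α` as a section. -/
theorem simplicialCircleMap_apply_of_injective {m n : ℕ} (α : Fin (m + 1) →o Fin (n + 1))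
    (hα : Function.Injective α) (i : Fin (m + 1)) : simplicialCircleMap α (α i) = i :=
  eq_of_forall_ge_iff fun l => (simplicialCircleMap_of_exists α (α i) ⟨i, le_rfl⟩ l).trans
    (α.monotone.strictMono_of_injective hα).le_iff_le

/-- Multiply together the entries whose indices have the same image. -/
def prodFiber {T : Type*} [CommMonoid T] {ι κ : Type*} [Fintype ι] [DecidableEq κ]
    (g : ι → κ) (c : ι → T) (j : κ) : T :=
  ∏ i with g i = j, c i

theorem prodFiber_mulSingle {T : Type*} [CommMonoid T] {ι κ : Type*} [Fintype ι] [DecidableEq ι]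
    [DecidableEq κ] (g : ι → κ) (a : ι) (t : T) :
    prodFiber g (Pi.mulSingle a t) = Pi.mulSingle (g a) t := by
  ext j
  simp only [prodFiber, Pi.mulSingle_apply, Finset.prod_ite_eq', Finset.mem_filter,
    Finset.mem_univ, true_and]
  simp only [eq_comm]

theorem dvd_prodFiber_const {T : Type*} [CommMonoid T] {ι κ : Type*} [Fintype ι]
    [DecidableEq κ] (g : ι → κ) (hg : Function.Surjective g) {t t' : T} (h : t ∣ t') (j : κ) :
    t ∣ prodFiber g (fun _ => t') j := by
  obtain ⟨i, hi⟩ := hg j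
  exact h.trans (Finset.dvd_prod_of_mem (fun _ => t') (by simpa using hi))

namespace AlgebraicTopology

open Simplicial Opposite

variable {R : Type*} [CommRing R]

/-- An action of the cyclic bar construction of a commutative monoid on a simplicial module. -/
structure CyclicBarAction (T : Type*) [CommMonoid T] (X : SimplicialObject (ModuleCat.{v} R)) where
  /-- The action of the `n`-simplices. -/
  act (n : ℕ) : (Fin (n + 1) → T) →* Module.End R (X _⦋n⦌)
  /-- The character by which the monoid of vertices acts. -/
  χ : T →* R
  map_act {m n : ℕ} (α : ⦋m⦌ ⟶ ⦋n⦌) (c : Fin (n + 1) → T) (x : X _⦋n⦌) :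
    X.map α.op (act n c x) =
      act m (prodFiber (simplicialCircleMap α.toOrderHom) c) (X.map α.op x)
  act_mulSingle_zero (n : ℕ) (t : T) (x : X _⦋n⦌) : act n (Pi.mulSingle 0 t) x = χ t • x

namespace CyclicBarAction

variable {T : Type*} [CommMonoid T] {X : SimplicialObject (ModuleCat.{v} R)}
  (a : CyclicBarAction T X)

theorem act_mul {n : ℕ} (c c' : Fin (n + 1) → T) (x : X _⦋n⦌) :
    a.act n (c * c') x = a.act n c (a.act n c' x) := by
  rw [map_mul]; rfl

theorem δ_act {n : ℕ} (i : Fin (n + 2)) (c : Fin (n + 2) → T) (x : X _⦋n + 1⦌) :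
    X.δ i (a.act (n + 1) c x) =
      a.act n (prodFiber (simplicialCircleMap (SimplexCategory.δ i).toOrderHom) c) (X.δ i x) :=
  a.map_act _ _ _

theorem facesVanish_act {n : ℕ} (c : Fin (n + 1) → T) {x : X _⦋n⦌} (hx : FacesVanish X x) :
    FacesVanish X (a.act n c x) := by
  cases n with
  | zero => trivial
  | succ n =>
    intro i
    rw [δ_act, hx i, map_zero]

theorem _root_.simplicialCircleMap_δ_self {k : ℕ} (i : Fin (k + 1)) :
    simplicialCircleMap (SimplexCategory.δ i.castSucc.castSucc).toOrderHom i.succ.castSucc =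
      i.castSucc := by
  rw [show i.succ.castSucc = (SimplexCategory.δ i.castSucc.castSucc).toOrderHom i.castSucc from
    (Fin.succAbove_castSucc_self i.castSucc).symm]
  exact simplicialCircleMap_apply_of_injective _ Fin.succAbove_right_injective _

set_option linter.unnecessarySeqFocus false in
theorem _root_.simplicialCircleMap_δ_succ {k : ℕ} (i : Fin (k + 1)) :
    simplicialCircleMap (SimplexCategory.δ i.succ.castSucc).toOrderHom i.succ.castSucc =
      i.succ := by
  have h (l : Fin (k + 2)) : i.succ.castSucc ≤ i.succ.castSucc.succAbove l ↔ i.succ ≤ l := by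
    rw [Fin.succAbove]
    split_ifs with hl <;> simp [Fin.le_def, Fin.lt_def] at * <;> omega
  exact eq_of_forall_ge_iff fun l => (simplicialCircleMap_of_exists _ _
    ⟨i.succ, (h _).2 le_rfl⟩ l).trans (h l)

/-- By the simplicial identities, every face of `σ l z` other than the two that cancel the
degeneracy is a degeneracy of a face of `z`. -/
theorem _root_.AlgebraicTopology.δ_σ_eq_zero {k : ℕ} {z : X _⦋k + 1⦌} (hz : FacesVanish X z)
    (l : Fin (k + 2)) (j : Fin (k + 3)) (h₁ : j ≠ l.castSucc) (h₂ : j ≠ l.succ) :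
    X.δ j (X.σ l z) = 0 := by
  rcases lt_or_gt_of_ne h₁ with h | h
  · obtain ⟨l, rfl⟩ := Fin.exists_succ_eq.2 (show l ≠ 0 by rintro rfl; simp at h)
    obtain ⟨j, rfl⟩ := Fin.exists_castSucc_eq.2 (h.trans_le (Fin.le_last _)).ne
    have := ConcreteCategory.congr_hom
      (X.δ_comp_σ_of_le (i := j) (j := l) (by simp [Fin.le_def, Fin.lt_def] at *; omega)) z
    refine this.trans ?_
    change X.σ l (X.δ j z) = 0
    rw [hz, map_zero]
  · have := ConcreteCategory.congr_hom (X.δ_comp_σ_of_gt' (i := j) (j := l)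
      (lt_of_le_of_ne (by simp [Fin.le_def, Fin.lt_def] at *; omega) h₂.symm)) z
    refine this.trans ?_
    change X.σ _ (X.δ _ z) = 0
    rw [hz, map_zero]

/-- Degenerate `z` at `i` and put `t` in the new slot `i + 1`. Only faces `i` and `i + 1` survive:
the first merges `t` into slot `i`, the second leaves it in slot `i + 1`. -/
theorem act_castSucc_sub_act_succ_mem {k : ℕ} {z : X _⦋k + 1⦌} (hz : FacesVanish X z)
    (i : Fin (k + 1)) (t : T) :
    a.act _ (Pi.mulSingle i.succ t) z - a.act _ (Pi.mulSingle i.castSucc t) z ∈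
      LinearMap.range (faceSum X (k + 1)) := by
  let w := a.act _ (Pi.mulSingle i.succ.castSucc t) (X.σ i.castSucc z)
  have h₀ : X.δ i.castSucc.castSucc w = a.act _ (Pi.mulSingle i.castSucc t) z := by
    rw [δ_act, prodFiber_mulSingle, simplicialCircleMap_δ_self]
    congr 1
    exact ConcreteCategory.congr_hom (X.δ_comp_σ_self (i := i.castSucc)) z
  have h₁ : X.δ i.succ.castSucc w = a.act _ (Pi.mulSingle i.succ t) z := by
    rw [δ_act, prodFiber_mulSingle, simplicialCircleMap_δ_succ]
    congr 1
    exact ConcreteCategory.congr_hom (X.δ_comp_σ_succ (i := i.castSucc)) z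
  have hw : faceSum X (k + 1) w = (-1 : ℤ) ^ (i : ℕ) •
      (a.act _ (Pi.mulSingle i.castSucc t) z - a.act _ (Pi.mulSingle i.succ t) z) := by
    rw [faceSum_apply, Finset.sum_eq_add i.castSucc.castSucc i.succ.castSucc
      (by simp [Fin.ext_iff]) _ (by simp) (by simp), h₀, h₁]
    · simp [pow_succ, sub_eq_add_neg]
    · rintro j - ⟨h₁, h₂⟩
      rw [δ_act, δ_σ_eq_zero hz _ _ h₁ h₂, map_zero, smul_zero]
  -- This sign cancels the `(-1) ^ i` of face `i` and reverses the difference.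
  refine ⟨-(-1 : ℤ) ^ (i : ℕ) • w, ?_⟩
  rw [map_zsmul, hw, smul_smul, neg_mul, ← pow_add, ← two_mul, pow_mul]
  simp

theorem act_mulSingle_sub_smul_mem {n : ℕ} {z : X _⦋n⦌} (hz : FacesVanish X z) (j : Fin (n + 1))
    (t : T) : a.act n (Pi.mulSingle j t) z - a.χ t • z ∈ LinearMap.range (faceSum X n) := by
  induction j using Fin.induction with
  | zero => rw [act_mulSingle_zero, sub_self]; exact zero_mem _
  | succ i ih =>
    cases n with
    | zero => exact i.elim0
    | succ k => simpa using add_mem (a.act_castSucc_sub_act_succ_mem hz i t) ih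

/-- The entries of `c` are moved to slot 0 one at a time; `facesVanish_act` keeps the faces zero
after each multiplication. -/
theorem act_sub_smul_mem {n : ℕ} {z : X _⦋n⦌} (hz : FacesVanish X z) (c : Fin (n + 1) → T) :
    a.act n c z - (∏ j, a.χ (c j)) • z ∈ LinearMap.range (faceSum X n) := by
  suffices h : ∀ F : Finset (Fin (n + 1)), a.act n (∏ j ∈ F, Pi.mulSingle j (c j)) z -
      (∏ j ∈ F, a.χ (c j)) • z ∈ LinearMap.range (faceSum X n) by
    simpa only [Finset.univ_prod_mulSingle] using h Finset.univ
  intro F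
  induction F using Finset.induction_on with
  | empty => simp
  | insert j F hj ih =>
    rw [Finset.prod_insert hj, Finset.prod_insert hj, act_mul, mul_smul]
    have := add_mem (a.act_mulSingle_sub_smul_mem (a.facesVanish_act
      (∏ j ∈ F, Pi.mulSingle j (c j)) hz) j (c j)) (Submodule.smul_mem _ (a.χ (c j)) ih)
    rwa [smul_sub, sub_add_sub_cancel] at this

/-- The action of `c` need not be invertible on chains, but on the class of `z` it is multiplication
by a unit and can be cancelled. -/
theorem mem_range_of_act_mem (hχ : ∀ t, IsUnit (a.χ t)) {n : ℕ} {z : X _⦋n⦌}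
    (hz : FacesVanish X z) (c : Fin (n + 1) → T)
    (h : a.act n c z ∈ LinearMap.range (faceSum X n)) : z ∈ LinearMap.range (faceSum X n) := by
  have hu : IsUnit (∏ j, a.χ (c j)) := IsUnit.prod_univ_iff.2 fun j => hχ _
  have := sub_mem h (a.act_sub_smul_mem hz c)
  rw [sub_sub_cancel] at this
  simpa [smul_smul] using Submodule.smul_mem _ (↑hu.unit⁻¹ : R) this

end CyclicBarAction

/-! ### From degreewise localization to quasi-isomorphism -/

variable {T : Type*} [CommMonoid T] {X Y : SimplicialObject (ModuleCat.{v} R)}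

/-- A map of simplicial modules with an action of the cyclic bar construction of `T` is a
quasi-isomorphism if it is a localization in every degree, and the vertices of the cyclic bar
construction act invertibly. -/
theorem CyclicBarAction.quasiIso (a : CyclicBarAction T X) (b : CyclicBarAction T Y) (φ : X ⟶ Y)
    (hφ : ∀ n c x, φ.app (op ⦋n⦌) (a.act n c x) = b.act n c (φ.app (op ⦋n⦌) x))
    (ha : ∀ t, IsUnit (a.χ t)) (hb : ∀ t, IsUnit (b.χ t))
    (surj : ∀ n (y : Y _⦋n⦌), ∃ t x, b.act n (fun _ => t) y = φ.app (op ⦋n⦌) x)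
    (inj : ∀ n (x : X _⦋n⦌), φ.app (op ⦋n⦌) x = 0 → ∃ t, a.act n (fun _ => t) x = 0) :
    QuasiIso ((alternatingFaceMapComplex _).map φ) := by
  have hδ {n : ℕ} (i : Fin (n + 2)) :
      Function.Surjective (simplicialCircleMap (SimplexCategory.δ i).toOrderHom) := fun l =>
    ⟨_, simplicialCircleMap_apply_of_injective _ Fin.succAbove_right_injective l⟩
  have hφδ {n : ℕ} (i : Fin (n + 2)) (x : X _⦋n + 1⦌) :
      φ.app (op ⦋n⦌) (X.δ i x) = Y.δ i (φ.app (op ⦋n + 1⦌) x) :=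
    ConcreteCategory.congr_hom (φ.naturality (SimplexCategory.δ i).op) x
  -- Faces turn constant tuples into non-constant ones, so the killing must extend to all tuples
  -- with entries divisible by `t`.
  have inj' {n : ℕ} (x : X _⦋n⦌) (hx : φ.app (op ⦋n⦌) x = 0) :
      ∃ t, ∀ c : Fin (n + 1) → T, (∀ j, t ∣ c j) → a.act n c x = 0 := by
    obtain ⟨t, ht⟩ := inj n x hx
    refine ⟨t, fun c hc => ?_⟩
    choose c' hc' using hc
    rw [show c = c' * fun _ => t from funext fun j => (hc' j).trans (mul_comm _ _), act_mul, ht,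
      map_zero]
  have kill {n : ℕ} {ι : Type} [Fintype ι] (x : ι → X _⦋n⦌) (hx : ∀ i, φ.app (op ⦋n⦌) (x i) = 0) :
      ∃ t, ∀ c : Fin (n + 1) → T, (∀ j, t ∣ c j) → ∀ i, a.act n c (x i) = 0 := by
    choose t ht using fun i => inj' (x i) (hx i)
    exact ⟨∏ i, t i, fun c hc i => ht i c fun j =>
      (Finset.dvd_prod_of_mem t (Finset.mem_univ i)).trans (hc j)⟩
  refine ChainComplex.moduleCat_quasiIso _ (fun n (z : Y _⦋n⦌) hz => ?_)
    (fun n (y : X _⦋n⦌) hy w hw => ?_)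
  · have hz' := facesVanish_normalize Y z hz
    obtain ⟨t, x, hx⟩ := surj n (normalize Y n z)
    -- The faces of the lift `x` vanish only after `φ`; there are finitely many, so one further
    -- multiplication kills them in `X`.
    obtain ⟨t', ht'⟩ : ∃ t', FacesVanish X (a.act n (fun _ => t') x) := by
      cases n with
      | zero => exact ⟨1, trivial⟩
      | succ n =>
        obtain ⟨t', ht'⟩ := kill (fun i => X.δ i x) fun i => by
          rw [hφδ, ← hx]
          exact b.facesVanish_act _ hz' i
        refine ⟨t', fun i => ?_⟩
        rw [δ_act]
        exact ht' _ (dvd_prodFiber_const _ (hδ i) dvd_rfl) i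
    let c : Fin (n + 1) → T := (fun _ => t') * fun _ => t
    have hu : IsUnit (∏ j, b.χ (c j)) := IsUnit.prod_univ_iff.2 fun j => hb _
    -- Dividing by the scalar through which `c` acts on homology makes the image of `y` homologous
    -- to `z`.
    let y : X _⦋n⦌ := (↑hu.unit⁻¹ : R) • a.act n (fun _ => t') x
    have hy : φ.app (op ⦋n⦌) y = (↑hu.unit⁻¹ : R) • b.act n c (normalize Y n z) := by
      rw [map_smul, hφ, ← hx, act_mul]
    refine ⟨y, fun m => ?_, ?_⟩
    · refine (map_smul _ _ _).trans ?_
      rw [d_eq_zero_of_facesVanish _ _ ht', smul_zero]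
    · have h := Submodule.smul_mem _ (↑hu.unit⁻¹ : R) (b.act_sub_smul_mem hz' c)
      rw [smul_sub, smul_smul, IsUnit.val_inv_mul, one_smul, ← hy] at h
      have h' := add_mem h (normalize_sub_mem_range Y z hz)
      rw [sub_add_sub_cancel] at h'
      obtain ⟨w, hw⟩ := h'
      exact ⟨w, hw.symm.trans (alternatingFaceMapComplex_d_apply Y n w).symm⟩
  · have hy' := facesVanish_normalize X y hy
    have hw' : φ.app (op ⦋n⦌) (normalize X n y) = Y.δ 0 (normalize Y (n + 1) w) := by
      rw [← normalize_naturality, ← faceSum_eq_of_higher _ _ _ (δ_succ_normalize Y n w),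
        faceSum_normalize, ← alternatingFaceMapComplex_d_apply]
      exact congrArg _ hw
    obtain ⟨t, x, hx⟩ := surj (n + 1) (normalize Y (n + 1) w)
    -- Face 0 merges slots 0 and 1, so `e` is not constant: its entry 0 is `t ^ 2`.
    let e : Fin (n + 1) → T :=
      prodFiber (simplicialCircleMap (SimplexCategory.δ (0 : Fin (n + 2))).toOrderHom) fun _ => t
    obtain ⟨t₁, ht₁⟩ := kill (fun i : Fin (n + 1) => X.δ i.succ x) fun i => by
      rw [hφδ, ← hx, δ_act, δ_succ_normalize, map_zero]
    obtain ⟨t₂, ht₂⟩ := inj' (X.δ 0 x - a.act n e (normalize X n y)) (by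
      rw [map_sub, hφδ, ← hx, δ_act, hφ, hw', sub_self])
    -- The factor `t₁` kills the higher faces of `x`; `t₂` makes its face 0 agree in `X` with a
    -- multiple of the normalized `y`. That multiple is thus a boundary, and the multiplier cancels
    -- on homology.
    have hx' : faceSum X n (a.act (n + 1) (fun _ => t₁ * t₂) x) =
        a.act n (prodFiber (simplicialCircleMap (SimplexCategory.δ (0 : Fin (n + 2))).toOrderHom)
          (fun _ => t₁ * t₂) * e) (normalize X n y) := by
      rw [faceSum_eq_of_higher, δ_act, act_mul, ← sub_eq_zero, ← map_sub]
      · exact ht₂ _ (dvd_prodFiber_const _ (hδ 0) (dvd_mul_left _ _))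
      · intro i
        rw [δ_act]
        exact ht₁ _ (dvd_prodFiber_const _ (hδ _) (dvd_mul_right _ _)) i
    have h := a.mem_range_of_act_mem ha hy' _ ⟨_, hx'⟩
    obtain ⟨v, hv⟩ := sub_mem h (normalize_sub_mem_range X y hy)
    rw [sub_sub_cancel] at hv
    exact ⟨v, hv.symm.trans (alternatingFaceMapComplex_d_apply X n v).symm⟩

end AlgebraicTopology

/-! ### Divisors of powers of `f` in a localization -/

/-- A divisor of a product of elements `p`, each of which is regular and divides one of the factors
of any product that it divides, is a unit times a product of such elements. -/
theorem exists_eq_unit_mul_of_dvd {B : Type*} [CommRing B] {P : Set B}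
    (hP : ∀ p ∈ P, IsRegular p ∧ ∀ x y, p ∣ x * y → p ∣ x ∨ p ∣ y) {g : B}
    (hg : g ∈ Submonoid.closure P) {b : B} (hb : b ∣ g) :
    ∃ u : Bˣ, ∃ q ∈ Submonoid.closure P, b = u * q := by
  induction hg using Submonoid.closure_induction_left generalizing b with
  | one => exact ⟨(isUnit_of_dvd_one hb).unit, 1, one_mem _, by simp⟩
  | mul_left p hp g _ ih =>
    obtain ⟨c, hc⟩ := hb
    obtain ⟨hreg, hprime⟩ := hP p hp
    -- Cancel `p` from whichever of `b` and `c` it divides; in the first case it becomes a factor of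
    -- `q`.
    rcases hprime b c ⟨g, hc.symm⟩ with ⟨b', rfl⟩ | ⟨c', rfl⟩
    · obtain ⟨u, q, hq, rfl⟩ := ih ⟨c, hreg.left (by simpa only [mul_assoc] using hc)⟩
      exact ⟨u, p * q, mul_mem (Submonoid.subset_closure hp) hq, by ring⟩
    · exact ih ⟨c', hreg.left (by simpa only [mul_left_comm] using hc)⟩

/-- A prime of `A` may become a unit in `B`, so only the divisibility alternative is kept, not
`Prime`. -/
theorem dvd_or_dvd_map_of_prime {A : Type*} [CommRing A] (S : Submonoid A) {B : Type*} [CommRing B]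
    [Algebra A B] [IsLocalization S B] {p : A} (hp : Prime p) (x y : B)
    (h : algebraMap A B p ∣ x * y) : algebraMap A B p ∣ x ∨ algebraMap A B p ∣ y := by
  obtain ⟨x, s, rfl⟩ := IsLocalization.exists_mk'_eq S x
  obtain ⟨y, t, rfl⟩ := IsLocalization.exists_mk'_eq S y
  have hdvd {x : A} (s : S) : algebraMap A B p ∣ IsLocalization.mk' B x s ↔
      algebraMap A B p ∣ algebraMap A B x := by
    rw [← IsLocalization.mk'_spec B x s, (IsLocalization.map_units B s).dvd_mul_right]
  rw [← IsLocalization.mk'_mul, hdvd] at h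
  rw [hdvd, hdvd]
  obtain ⟨z, hz⟩ := h
  obtain ⟨z, r, rfl⟩ := IsLocalization.exists_mk'_eq S z
  have h' : algebraMap A B (x * y * r) = algebraMap A B (p * z) := by
    rw [map_mul, hz, mul_assoc, IsLocalization.mk'_spec, map_mul]
  obtain ⟨c, hc⟩ := (IsLocalization.eq_iff_exists S B).1 h'
  have hpc : p ∣ (c * r : S) * (x * y) := ⟨c * z, by
    rw [Submonoid.coe_mul]; linear_combination hc⟩
  rcases hp.dvd_or_dvd hpc with h | h
  -- Here `p` divides an element of `S`, hence is a unit of `B` and divides everything.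
  · exact .inl ((isUnit_of_dvd_unit (map_dvd (algebraMap A B) h)
      (IsLocalization.map_units B (c * r))).dvd)
  · exact (hp.dvd_or_dvd h).imp (map_dvd _) (map_dvd _)

section

variable {A : Type*} [CommRing A] {f : A}

theorem isRegular_of_dvd {p : A} (hf : f ∈ nonZeroDivisors A) (h : p ∣ f) : IsRegular p := by
  obtain ⟨c, rfl⟩ := h
  exact isRegular_iff_mem_nonZeroDivisors.2 (mul_mem_nonZeroDivisors.1 hf).1

/-- If `f` is a product of prime divisors `p ∈ P` of `f`, then, in a localization `B` of `A`,
a divisor of a power of `f` is a unit times a product of elements of `P`. -/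
theorem exists_eq_unit_mul_algebraMap_of_dvd (S : Submonoid A) {B : Type*} [CommRing B]
    [Algebra A B] [IsLocalization S B] {P : Set A} (hf : f ∈ nonZeroDivisors A)
    (hP : ∀ p ∈ P, Prime p ∧ p ∣ f) (hfP : f ∈ Submonoid.closure P) {b : B} {N : ℕ}
    (hb : b ∣ algebraMap A B f ^ N) :
    ∃ u : Bˣ, ∃ q ∈ Submonoid.closure P, b = u * algebraMap A B q := by
  have hmap : (Submonoid.closure P).map (algebraMap A B) =
      Submonoid.closure (algebraMap A B '' P) := MonoidHom.map_mclosure _ _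
  obtain ⟨u, q, hq, rfl⟩ := exists_eq_unit_mul_of_dvd (P := algebraMap A B '' P) (by
    rintro _ ⟨p, hp, rfl⟩
    refine ⟨?_, dvd_or_dvd_map_of_prime S (hP p hp).1⟩
    exact isRegular_iff_mem_nonZeroDivisors.2 (IsLocalization.map_nonZeroDivisors_le S B
      ⟨p, isRegular_iff_mem_nonZeroDivisors.1 (isRegular_of_dvd hf (hP p hp).2), rfl⟩))
    (g := algebraMap A B f ^ N) (pow_mem (by rw [← hmap]; exact ⟨f, hfP, rfl⟩) N) hb
  rw [← hmap] at hq
  obtain ⟨q, hq, rfl⟩ := hq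
  exact ⟨u, q, hq, rfl⟩

theorem isUnit_algebraMap_of_mem_closure {P : Set A} (hP : ∀ p ∈ P, p ∣ f) {q : A}
    (hq : q ∈ Submonoid.closure P) (C : Type*) [CommRing C] [Algebra A C]
    [IsLocalization.Away f C] : IsUnit (algebraMap A C q) := by
  induction hq using Submonoid.closure_induction with
  | one => simp
  | mul x y _ _ hx hy => rw [map_mul]; exact hx.mul hy
  | mem p hp =>
    exact isUnit_of_dvd_unit (map_dvd _ (hP p hp)) (IsLocalization.Away.algebraMap_isUnit f)

/-- Clear the denominator `g ^ N` of the inverse of `b`; the resulting identity descends to `B`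
because `g` is a nonzerodivisor. -/
theorem exists_dvd_pow_of_isUnit_algebraMap {B D : Type*} [CommRing B] [CommRing D] (g : B)
    [Algebra B D] [IsLocalization.Away g D] (hg : g ∈ nonZeroDivisors B) {b : B}
    (hb : IsUnit (algebraMap B D b)) : ∃ N, b ∣ g ^ N := by
  obtain ⟨y, hy⟩ := hb.exists_right_inv
  obtain ⟨N, c, hc⟩ := IsLocalization.Away.surj g y
  refine ⟨N, c, IsLocalization.injective D (Submonoid.powers_le.2 hg) ?_⟩
  rw [map_mul, ← hc, ← mul_assoc, hy, one_mul, map_pow]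

end

/-! ### Units of `B[f⁻¹]` and descent of replete tensors -/

section

variable {k : Type*} [CommRing k] {A : Type u} [CommRing A] [Algebra k A] {f : A}

theorem mem_nonZeroDivisors_algebraMap (S : Submonoid A) {B : Type*} [CommRing B] [Algebra A B]
    [IsLocalization S B] (hf : f ∈ nonZeroDivisors A) : algebraMap A B f ∈ nonZeroDivisors B :=
  IsLocalization.map_nonZeroDivisors_le S B ⟨f, hf, rfl⟩

theorem exists_eq_unit_mul_of_algebraMap_eq_unit (S : Submonoid A) {B : Type*} [CommRing B]
    [Algebra A B] [IsLocalization S B]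
    {P : Set A} (hf : f ∈ nonZeroDivisors A) (hP : ∀ p ∈ P, Prime p ∧ p ∣ f)
    (hfP : f ∈ Submonoid.closure P) {b : B}
    (hb : IsUnit (algebraMap B (Localization.Away (algebraMap A B f)) b)) :
    ∃ (u : Bˣ) (q : A), IsUnit (algebraMap A (Localization.Away f) q) ∧
      b = u * algebraMap A B q := by
  obtain ⟨N, hN⟩ := exists_dvd_pow_of_isUnit_algebraMap (algebraMap A B f)
    (mem_nonZeroDivisors_algebraMap S hf) hb
  obtain ⟨u, q, hq, h⟩ := exists_eq_unit_mul_algebraMap_of_dvd S hf hP hfP hN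
  exact ⟨u, q, isUnit_algebraMap_of_mem_closure (fun p hp => (hP p hp).2) hq _, h⟩

/-- A unit of `B[f⁻¹]` is the product of a unit of `B` and of a unit of `A[f⁻¹]`. -/
theorem exists_unit_eq_mul_map (S : Submonoid A) {B : Type u} [CommRing B] [Algebra k B]
    [Algebra A B] [IsScalarTower k A B] [IsLocalization S B]
    {P : Set A} (hf : f ∈ nonZeroDivisors A) (hP : ∀ p ∈ P, Prime p ∧ p ∣ f)
    (hfP : f ∈ Submonoid.closure P) (m : (Localization.Away (algebraMap A B f))ˣ) :
    ∃ (u : Bˣ) (v : (Localization.Away f)ˣ),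
      m = Units.map (algebraMap B (Localization.Away (algebraMap A B f))).toMonoidHom u *
        Units.map (awayBaseChange k A f B : _ →* _) v := by
  obtain ⟨N, c, hc⟩ := IsLocalization.Away.surj (algebraMap A B f) (m : Localization.Away (algebraMap A B f))
  have hF : IsUnit (algebraMap A (Localization.Away f) f) :=
    IsLocalization.Away.algebraMap_isUnit f
  have hFD : IsUnit (algebraMap B (Localization.Away (algebraMap A B f)) (algebraMap A B f)) :=
    IsLocalization.Away.algebraMap_isUnit _
  obtain ⟨u, q, ⟨v, hv⟩, rfl⟩ := exists_eq_unit_mul_of_algebraMap_eq_unit S hf hP hfP (b := c)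
    (by rw [← hc]; exact m.isUnit.mul (hFD.pow N))
  -- From `m * f ^ N = c = u * q` in `B[f⁻¹]`, the unit over `A[f⁻¹]` is `q / f ^ N`.
  refine ⟨u, v * (hF.unit ^ N)⁻¹, ?_⟩
  rw [map_mul, ← mul_assoc, map_inv, eq_mul_inv_iff_mul_eq, Units.ext_iff]
  simp only [Units.val_mul, Units.coe_map, map_pow, Units.val_pow_eq_pow_val]
  change (m : Localization.Away (algebraMap A B f)) * awayBaseChange k A f B hF.unit ^ N =
    algebraMap B _ u * awayBaseChange k A f B v
  rw [IsUnit.unit_spec, hv, awayBaseChange_algebraMap, awayBaseChange_algebraMap, hc, map_mul]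

/-- Split each `m i` into a unit `u i` of `B` and a unit `v i` of `A[f⁻¹]`. The `u i` join the
coefficients, whose denominators are then cleared by one `s`. The product of the `v i` need not lie
in `A`, so the splitting is first corrected in slot `i₀`. -/
theorem exists_smul_mul_unit_eq {ι : Type*} [Fintype ι] [DecidableEq ι] (i₀ : ι)
    (S : Submonoid A) {B : Type u} [CommRing B] [Algebra k B]
    [Algebra A B] [IsScalarTower k A B] [IsLocalization S B] {P : Set A} (hf : f ∈ nonZeroDivisors A) (hP : ∀ p ∈ P, Prime p ∧ p ∣ f)
    (hfP : f ∈ Submonoid.closure P) (a : ι → B)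
    (m : ι → (Localization.Away (algebraMap A B f))ˣ)
    (hm : ∃ b : B, algebraMap B _ b = ∏ i, (m i : Localization.Away (algebraMap A B f))) :
    ∃ (s : S) (α : ι → A) (v : ι → (Localization.Away f)ˣ),
      (∃ q : A, algebraMap A (Localization.Away f) q = ∏ i, (v i : Localization.Away f)) ∧
      ∀ i, algebraMap B _ (algebraMap A B s) *
          (algebraMap B (Localization.Away (algebraMap A B f)) (a i) * m i) =
        awayBaseChange k A f B (algebraMap A _ (α i) * v i) := by
  let D := Localization.Away (algebraMap A B f)
  let I : Bˣ →* Dˣ := Units.map (algebraMap B D).toMonoidHom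
  let F : (Localization.Away f)ˣ →* Dˣ := Units.map (awayBaseChange k A f B : _ →* _)
  have hI (u : Bˣ) : (I u : D) = algebraMap B D u := rfl
  have hF (v : (Localization.Away f)ˣ) : (F v : D) = awayBaseChange k A f B v := rfl
  choose u v huv using fun i => exists_unit_eq_mul_map (k := k) S hf hP hfP (m i)
  change ∀ i, m i = I (u i) * F (v i) at huv
  obtain ⟨b, hb⟩ := hm
  rw [← Units.coe_prod] at hb
  obtain ⟨u₀, q, ⟨V, hV⟩, rfl⟩ := exists_eq_unit_mul_of_algebraMap_eq_unit S hf hP hfP (b := b)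
    (by rw [hb]; exact Units.isUnit _)
  -- The two splittings `u₀ * V` and `(∏ u) * (∏ v)` of the same product differ by units that cancel
  -- in `B[f⁻¹]`, so both corrections can be inserted in slot `i₀` without changing `m i₀`.
  have hprod : I (u₀ / ∏ i, u i) * F (V / ∏ i, v i) = 1 := by
    rw [map_div, map_div, div_mul_div_comm, div_eq_one, map_prod, map_prod,
      ← Finset.prod_mul_distrib, ← Finset.prod_congr rfl fun i _ => huv i, Units.ext_iff, ← hb,
      Units.val_mul, hI, hF, hV, awayBaseChange_algebraMap, map_mul]
  let u' := u * Pi.mulSingle i₀ (u₀ / ∏ i, u i)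
  let v' := v * Pi.mulSingle i₀ (V / ∏ i, v i)
  have huv' (i : ι) : m i = I (u' i) * F (v' i) := by
    simp only [u', v', Pi.mul_apply, map_mul]
    rw [mul_mul_mul_comm, ← huv]
    by_cases hi : i = i₀
    · subst hi
      rw [Pi.mulSingle_eq_same, Pi.mulSingle_eq_same, hprod, mul_one]
    · simp [hi]
  obtain ⟨s, hs⟩ := IsLocalization.exist_integer_multiples_of_finite S fun i => a i * u' i
  choose α hα using hs
  refine ⟨s, α, v', ⟨q, ?_⟩, fun i => ?_⟩
  · rw [← Units.coe_prod, ← hV]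
    congr 1
    simp only [v', Pi.mul_apply, Finset.prod_mul_distrib]
    rw [Fintype.prod_eq_single (f := Pi.mulSingle i₀ (V / ∏ i, v i)) i₀
      fun i hi => Pi.mulSingle_eq_of_ne hi _, Pi.mulSingle_eq_same,
      mul_div_cancel]
  · rw [huv', map_mul, awayBaseChange_algebraMap, hα, Units.val_mul, hI, hF, Algebra.smul_def,
      map_mul, map_mul]
    ring

end

/-! ### The kernel on tensor powers -/

section

variable {k : Type*} [CommRing k] {A : Type u} [CommRing A] [Algebra k A] {f : A}
  (S : Submonoid A) (B : Type u) [CommRing B] [Algebra k B] [Algebra A B] [IsScalarTower k A B]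
  [IsLocalization S B]

/-- This is the existence half of the universal property of `B[f⁻¹]` as the localization of `A[f⁻¹]`
at `S`. -/
theorem exists_algHom_comp_awayBaseChange {L : Type*} [CommRing L] [Algebra k L]
    (θ : Localization.Away f →ₐ[k] L) (hθ : ∀ s ∈ S, IsUnit (θ (algebraMap A _ s))) :
    ∃ ψ : Localization.Away (algebraMap A B f) →ₐ[k] L, ∀ c, ψ (awayBaseChange k A f B c) = θ c := by
  let g : B →+* L := IsLocalization.lift (M := S)
    (g := (θ : Localization.Away f →+* L).comp (algebraMap A (Localization.Away f)))
    fun s => hθ s s.2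
  have hg (a : A) : g (algebraMap A B a) = θ (algebraMap A _ a) := IsLocalization.lift_eq _ a
  have hgf : IsUnit (g (algebraMap A B f)) := by
    rw [hg]
    exact (IsLocalization.Away.algebraMap_isUnit f).map θ
  let h : Localization.Away (algebraMap A B f) →+* L := IsLocalization.Away.lift _ hgf
  have hh (b : B) : h (algebraMap B _ b) = g b := IsLocalization.Away.lift_eq _ hgf b
  refine ⟨{ h with commutes' := fun r => ?_ }, fun c => ?_⟩
  · change h _ = _
    rw [IsScalarTower.algebraMap_apply k B (Localization.Away (algebraMap A B f)),
      IsScalarTower.algebraMap_apply k A B, hh, hg,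
      ← IsScalarTower.algebraMap_apply k A (Localization.Away f), AlgHom.commutes]
  · change (h.comp (awayBaseChange k A f B : Localization.Away f →+* _)) c =
      (θ : Localization.Away f →+* L) c
    congr 1
    refine IsLocalization.ringHom_ext (Submonoid.powers f) (RingHom.ext fun a => ?_)
    change h (awayBaseChange k A f B (algebraMap A _ a)) = θ (algebraMap A _ a)
    rw [awayBaseChange_algebraMap, hh, hg]

/-- The tensor `s ⊗ ⋯ ⊗ s`. -/
noncomputable def constTensor (k : Type*) [CommRing k] {ι : Type*} {A C : Type*} [CommRing A]
    [CommRing C] [Algebra k C] [Algebra A C] : A →* ⨂[k] _ : ι, C where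
  toFun s := PiTensorProduct.tprod k fun _ => algebraMap A C s
  map_one' := by simp only [map_one]; rfl
  map_mul' s t := by simp only [map_mul, PiTensorProduct.tprod_mul_tprod]; rfl

theorem prod_single_eq_tprod {ι : Type*} [Fintype ι] [DecidableEq ι] {C : Type*} [CommRing C]
    [Algebra k C] (c : ι → C) :
    ∏ i, PiTensorProduct.singleAlgHom (R := k) (A := fun _ : ι => C) i (c i) =
      PiTensorProduct.tprod k c := by
  change ∏ i, PiTensorProduct.tprod k (Pi.mulSingle i (c i)) = _
  rw [← PiTensorProduct.tprod_prod, Finset.univ_prod_mulSingle]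

/-- Let `L` invert the tensors `s ⊗ ⋯ ⊗ s`. The map to `L` factors through the tensor power of
`B[f⁻¹]`, so `x` dies in `L`, hence is killed by one such tensor. -/
theorem exists_constTensor_mul_eq_zero {ι : Type*} [Fintype ι] [DecidableEq ι]
    (x : ⨂[k] _ : ι, Localization.Away f)
    (hx : tensorMap id (awayBaseChange k A f B) x = 0) :
    ∃ s ∈ S, constTensor k s * x = 0 := by
  let T : Submonoid (⨂[k] _ : ι, Localization.Away f) := S.map (constTensor k)
  let L := Localization T
  let θ (i : ι) : Localization.Away f →ₐ[k] L :=
    (IsScalarTower.toAlgHom k (⨂[k] _ : ι, Localization.Away f) L).comp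
      (PiTensorProduct.singleAlgHom (R := k) (A := fun _ : ι => Localization.Away f) i)
  have hprod (c : ι → Localization.Away f) :
      ∏ i, θ i (c i) = algebraMap _ L (PiTensorProduct.tprod k c) := by
    rw [← prod_single_eq_tprod, map_prod]
    rfl
  -- The unit `s ⊗ ⋯ ⊗ s` is the product of the copies of `s` in the single slots, so each copy is a
  -- unit.
  have hθ (i : ι) (s : A) (hs : s ∈ S) : IsUnit (θ i (algebraMap A _ s)) := by
    have h : IsUnit (∏ i, θ i (algebraMap A _ s)) := by
      rw [hprod]
      exact IsLocalization.map_units L (⟨_, s, hs, rfl⟩ : T)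
    exact IsUnit.prod_univ_iff.1 h i
  have hex (i : ι) := exists_algHom_comp_awayBaseChange (k := k) (f := f) (L := L) S B (θ i) (hθ i)
  choose ψ hψ using hex
  let Ψ : (⨂[k] _ : ι, Localization.Away (algebraMap A B f)) →ₗ[k] L :=
    PiTensorProduct.lift ((MultilinearMap.mkPiAlgebra k ι L).compLinearMap
      fun i => (ψ i).toLinearMap)
  have hΨ (y : ⨂[k] _ : ι, Localization.Away f) :
      Ψ (tensorMap id (awayBaseChange k A f B) y) = algebraMap _ L y := by
    induction y using PiTensorProduct.induction_on with
    | smul_tprod r c =>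
      have hr : algebraMap _ L (r • PiTensorProduct.tprod k c) =
          r • algebraMap _ L (PiTensorProduct.tprod k c) :=
        map_smul (IsScalarTower.toAlgHom k (⨂[k] _ : ι, Localization.Away f) L) r _
      rw [map_smul, map_smul, tensorMap_tprod, PiTensorProduct.lift.tprod, hr, ← hprod]
      simp [Finset.filter_eq', hψ]
    | add y z hy hz => rw [map_add, map_add, map_add, hy, hz]
  have h := hΨ x
  rw [hx, map_zero] at h
  obtain ⟨⟨_, s, hs, rfl⟩, h⟩ := (IsLocalization.map_eq_zero_iff T L x).1 h.symm
  exact ⟨s, hs, h⟩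

end

/-! ### The comparison map as a localization in each degree -/

noncomputable section

namespace PHHRing

variable (k : Type v) [CommRing k] (A : Type u) [CommRing A] [Algebra k A] (f : A)

/-- The elements `a₀ ⊗ ⋯ ⊗ aₙ`, with `aᵢ ∈ A`, of `PHH (A, f)ₙ`. -/
def pureTensor (n : ℕ) : (Fin (n + 1) → A) →* PHHRing k A f n where
  toFun c := ⟨PiTensorProduct.tprod k fun j => algebraMap A _ (c j),
    AddSubmonoid.subset_closure ⟨c, 1, ⟨1, by simp⟩, by simp⟩⟩
  map_one' := Subtype.ext (by
    change PiTensorProduct.tprod k _ = PiTensorProduct.tprod k _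
    congr 1; ext; simp)
  map_mul' c d := Subtype.ext (by
    change PiTensorProduct.tprod k _ = PiTensorProduct.tprod k _ * PiTensorProduct.tprod k _
    rw [PiTensorProduct.tprod_mul_tprod]; congr 1; ext; simp)

theorem pureTensor_val (n : ℕ) (c : Fin (n + 1) → A) :
    (pureTensor k A f n c).1 = PiTensorProduct.tprod k fun j => algebraMap A _ (c j) := rfl

theorem pureTensor_mulSingle_zero (n : ℕ) (a : A) :
    pureTensor k A f n (Pi.mulSingle 0 a) = algebraMap A _ a := by
  refine Subtype.ext ?_
  change PiTensorProduct.tprod k _ = PiTensorProduct.tprod k (Pi.mulSingle 0 (algebraMap A _ a))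
  congr 1
  ext j
  by_cases hj : j = 0
  · subst hj; simp
  · simp [hj]

theorem simplicialMap_pureTensor {m n : ℕ} (g : Fin (n + 1) → Fin (m + 1)) (hg : g 0 = 0)
    (c : Fin (n + 1) → A) : simplicialMap k f g hg (pureTensor k A f n c) =
      pureTensor k A f m (prodFiber g c) := by
  refine Subtype.ext ?_
  rw [simplicialMap_val, pureTensor_val, tensorMap_tprod, pureTensor_val]
  simp only [prodFiber, map_prod, AlgHom.id_apply]

variable (B : Type u) [CommRing B] [Algebra k B] [Algebra A B] [IsScalarTower k A B]

theorem map_val (n : ℕ) (x : PHHRing k A f n) :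
    (map k A f B n x).1 = tensorMap (k := k) id (awayBaseChange k A f B) x.1 := rfl

theorem map_pureTensor (n : ℕ) (c : Fin (n + 1) → A) :
    map k A f B n (pureTensor k A f n c) =
      pureTensor k B (algebraMap A B f) n fun j => algebraMap A B (c j) := by
  refine Subtype.ext ?_
  rw [map_val, pureTensor_val, tensorMap_tprod, pureTensor_val]
  congr 1
  ext j
  simp [Finset.filter_eq', awayBaseChange_algebraMap]

variable (S : Submonoid A) [IsLocalization S B]

include S in
theorem exists_pureTensor_mul_eq_zero (n : ℕ) (x : PHHRing k A f n)
    (hx : map k A f B n x = 0) :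
    ∃ s : S, pureTensor k A f n (fun _ => (s : A)) * x = 0 := by
  obtain ⟨s, hs, h⟩ := exists_constTensor_mul_eq_zero S B x.1 (congrArg Subtype.val hx)
  exact ⟨⟨s, hs⟩, Subtype.ext h⟩

/-- Since `B ⊗[A] -` is localization at `S`, some multiple `s • y` has the form `1 ⊗ x`, and `s`
acts invertibly; this reduces the claim to `x`. -/
theorem exists_comparison_eq_zero (n : ℕ) (y : B ⊗[A] PHHRing k A f n)
    (hy : comparison k A f B n y = 0) :
    ∃ s : S, (1 : B) ⊗ₜ[A] pureTensor k A f n (fun _ => (s : A)) * y = 0 := by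
  have : IsLocalizedModule S (TensorProduct.mk A B (PHHRing k A f n) 1) :=
    (isLocalizedModule_iff_isBaseChange S B _).2 (TensorProduct.isBaseChange A _ B)
  obtain ⟨⟨x, s⟩, hx⟩ := IsLocalizedModule.surj S (TensorProduct.mk A B (PHHRing k A f n) 1) y
  change (s : A) • y = 1 ⊗ₜ x at hx
  rw [← algebraMap_smul B (s : A) y] at hx
  obtain ⟨t, ht⟩ := exists_pureTensor_mul_eq_zero k A f B S n x (by
    rw [← one_mul (map k A f B n x), ← map_one (algebraMap B _), ← comparison_tmul, ← hx,
      map_smul, hy, smul_zero])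
  refine ⟨t, ((IsLocalization.map_units B s).smul_eq_zero).1 ?_⟩
  rw [← mul_smul_comm, hx, Algebra.TensorProduct.tmul_mul_tmul, ht, tmul_zero]

theorem exists_pureTensor_mul_eq_map (n : ℕ) {P : Set A} (hf : f ∈ nonZeroDivisors A)
    (hP : ∀ p ∈ P, Prime p ∧ p ∣ f) (hfP : f ∈ Submonoid.closure P)
    (y : PHHRing k B (algebraMap A B f) n) :
    ∃ (s : S) (x : PHHRing k A f n),
      pureTensor k B (algebraMap A B f) n (fun _ => algebraMap A B s) * y = map k A f B n x := by
  suffices h : ∀ z ∈ AddSubmonoid.closure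
      (repleteTensors k B (Localization.Away (algebraMap A B f)) n : Set _),
      ∃ (s : S) (x : PHHRing k A f n), constTensor k (algebraMap A B s) * z =
        tensorMap (k := k) id (awayBaseChange k A f B) x.1 by
    obtain ⟨s, x, hx⟩ := h y.1 y.2
    exact ⟨s, x, Subtype.ext hx⟩
  intro z hz
  induction hz using AddSubmonoid.closure_induction with
  | zero => exact ⟨1, 0, (mul_zero _).trans (map_zero _).symm⟩
  | add y z _ _ ihy ihz =>
    obtain ⟨s, x, hx⟩ := ihy
    obtain ⟨t, w, hw⟩ := ihz
    have hval (r : S) (x : PHHRing k A f n) : tensorMap (k := k) id (awayBaseChange k A f B)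
        (pureTensor k A f n (fun _ => (r : A)) * x).1 = constTensor k (algebraMap A B r) *
          tensorMap (k := k) id (awayBaseChange k A f B) x.1 := by
      have := congrArg Subtype.val (map_pureTensor k A f B n fun _ => (r : A))
      exact (map_mul _ _ _).trans (congrArg (· * _) this)
    -- Bring the two summands to the common denominator `s * t`.
    refine ⟨s * t, pureTensor k A f n (fun _ => (t : A)) * x +
      pureTensor k A f n (fun _ => (s : A)) * w, ?_⟩
    refine Eq.trans ?_ (map_add _ _ _).symm
    rw [hval, hval, ← hx, ← hw, Submonoid.coe_mul, map_mul, map_mul]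
    ring
  | mem y hy =>
    obtain ⟨a, m, hm, rfl⟩ := hy
    -- The argument `0` is the slot that absorbs the correction of the units; any slot would do.
    obtain ⟨s, α, v, hv, h⟩ := exists_smul_mul_unit_eq (k := k) 0 S hf hP hfP a m hm
    refine ⟨s, ⟨_, AddSubmonoid.subset_closure (show _ ∈ repleteTensors k A _ n from
      ⟨α, v, hv, rfl⟩)⟩, ?_⟩
    refine Eq.trans ?_ (tensorMap_tprod _ _ _).symm
    change PiTensorProduct.tprod k _ * PiTensorProduct.tprod k _ = _
    rw [PiTensorProduct.tprod_mul_tprod]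
    congr 1
    ext j
    simpa [Finset.filter_eq'] using h j

end PHHRing

end

/-! ### The actions of `S` and the conclusion -/

noncomputable section

open Simplicial Opposite AlgebraicTopology

/-- The simplicial module underlying a simplicial commutative algebra. -/
def simplicialAlgebraModule (R : Type u) [CommRing R] :
    SimplicialObject (CommAlgCat.{max v u} R) ⥤ SimplicialObject (ModuleCat.{max v u} R) :=
  (SimplicialObject.whiskering _ _).obj
    (forget₂ (CommAlgCat.{max v u} R) (AlgCat.{max v u} R) ⋙
      forget₂ (AlgCat.{max v u} R) (ModuleCat.{max v u} R))

/-- A map from the cyclic bar construction of `T` to a simplicial commutative algebra gives an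
action by multiplication. -/
def cyclicBarActionOfAlgebra {R : Type u} [CommRing R] {T : Type*} [CommMonoid T]
    (Z : SimplicialObject (CommAlgCat.{max v u} R))
    (e : ∀ n, (Fin (n + 1) → T) →* Z _⦋n⦌) (χ : T →* R)
    (map_e : ∀ {m n : ℕ} (α : ⦋m⦌ ⟶ ⦋n⦌) c, (Z.map α.op).hom (e n c) =
      e m (prodFiber (simplicialCircleMap α.toOrderHom) c))
    (e_zero : ∀ n t, e n (Pi.mulSingle 0 t) = algebraMap R _ (χ t)) :
    CyclicBarAction T ((simplicialAlgebraModule.{v} R).obj Z) where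
  act n := ((Algebra.lmul R (Z _⦋n⦌) : Z _⦋n⦌ →* Module.End R (Z _⦋n⦌))).comp (e n)
  χ := χ
  map_act α c x := by
    change (Z.map α.op).hom (e _ c * (show Z _⦋_⦌ from x)) =
      e _ _ * (Z.map α.op).hom (show Z _⦋_⦌ from x)
    rw [map_mul, map_e]
  act_mulSingle_zero n t x := by
    change e n _ * (show Z _⦋n⦌ from x) = χ t • (show Z _⦋n⦌ from x)
    rw [e_zero, Algebra.smul_def]

section

variable (k : Type v) [CommRing k] (A : Type u) [CommRing A] [Algebra k A] (f : A)
  (S : Submonoid A) (B : Type u) [CommRing B] [Algebra k B] [Algebra A B] [IsScalarTower k A B]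

/-- The cyclic bar construction of `S` acts on `PHH (A, f) ⊗_A B`. -/
def PHHBaseChange.action :
    CyclicBarAction S ((simplicialAlgebraModule.{v} B).obj (PHHBaseChange k A f B)) :=
  cyclicBarActionOfAlgebra (PHHBaseChange k A f B)
    (fun n => (Algebra.TensorProduct.includeRight :
      PHHRing k A f n →ₐ[A] B ⊗[A] PHHRing k A f n).toMonoidHom.comp
        ((PHHRing.pureTensor k A f n).comp (S.subtype.compLeft (Fin (n + 1)))))
    ((algebraMap A B).toMonoidHom.comp S.subtype)
    (fun {m n} α c => by
      change (1 : B) ⊗ₜ[A] PHHRing.simplicialMap k f _ (simplicialCircleMap_zero _)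
        (PHHRing.pureTensor k A f n fun j => (c j : A)) = 1 ⊗ₜ PHHRing.pureTensor k A f m _
      rw [PHHRing.simplicialMap_pureTensor]
      congr 2
      ext j
      simp [prodFiber])
    (fun n t => by
      have h : S.subtype.compLeft (Fin (n + 1)) (Pi.mulSingle 0 t) = Pi.mulSingle 0 (t : A) :=
        (Pi.mulSingle_op (fun _ => S.subtype) (fun _ => map_one _) 0 t).symm
      change (1 : B) ⊗ₜ[A] PHHRing.pureTensor k A f n _ = algebraMap A B t ⊗ₜ[A] 1
      rw [h, PHHRing.pureTensor_mulSingle_zero, Algebra.algebraMap_eq_smul_one,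
        Algebra.algebraMap_eq_smul_one, smul_tmul])

/-- The cyclic bar construction of `S` acts on `PHH (B, f)`. -/
def PHH.action : CyclicBarAction S
    ((simplicialAlgebraModule.{v} B).obj (PHH k B (algebraMap A B f))) :=
  cyclicBarActionOfAlgebra (PHH k B (algebraMap A B f))
    (fun n => (PHHRing.pureTensor k B (algebraMap A B f) n).comp
      (((algebraMap A B).toMonoidHom.comp S.subtype).compLeft (Fin (n + 1))))
    ((algebraMap A B).toMonoidHom.comp S.subtype)
    (fun {m n} α c => by
      change PHHRing.simplicialMap k (algebraMap A B f) _ (simplicialCircleMap_zero _)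
        (PHHRing.pureTensor k B (algebraMap A B f) n fun j => algebraMap A B (c j)) =
          PHHRing.pureTensor k B (algebraMap A B f) m _
      rw [PHHRing.simplicialMap_pureTensor]
      congr 1
      ext j
      simp [prodFiber])
    (fun n t => by
      refine Eq.trans ?_ (PHHRing.pureTensor_mulSingle_zero k B (algebraMap A B f) n
        (algebraMap A B t))
      refine congrArg (PHHRing.pureTensor k B (algebraMap A B f) n) ?_
      exact (Pi.mulSingle_op (fun _ => (algebraMap A B).toMonoidHom.comp S.subtype)
        (fun _ => map_one _) 0 t).symm)

end

end

theorem mainTheorem8 (k : Type v) [Field k] (A : Type u) [CommRing A] [Algebra k A] (f : A)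
    (hf : IsNormalCrossingModulusPair k A f)
    {n : ℕ} (p : Fin n → A) (r : Fin n → ℕ) (hp : ∀ i, Prime (p i)) (hr : ∀ i, 0 < r i)
    (hfp : f = ∏ i, p i ^ r i)
    (S : Submonoid A) (B : Type u) [CommRing B] [Algebra k B] [Algebra A B] [IsScalarTower k A B]
    [IsLocalization S B] :
    QuasiIso ((simplicialAlgebraComplex B).map (PHHComparison k A f B)) := by
  have hP : ∀ q ∈ Set.range p, Prime q ∧ q ∣ f := by
    rintro _ ⟨i, rfl⟩
    exact ⟨hp i, hfp ▸ (dvd_pow_self _ (hr i).ne').trans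
      (Finset.dvd_prod_of_mem _ (Finset.mem_univ i))⟩
  have hfP : f ∈ Submonoid.closure (Set.range p) := by
    rw [hfp]
    exact prod_mem fun i _ => pow_mem (Submonoid.subset_closure (Set.mem_range_self i)) _
  -- In both actions the character is `S → A → B`, whose values are units because `B` is the
  -- localization at `S`.
  refine AlgebraicTopology.CyclicBarAction.quasiIso (PHHBaseChange.action k A f S B)
    (PHH.action k A f S B) ((simplicialAlgebraModule.{v} B).map (PHHComparison k A f B)) ?_
    (IsLocalization.map_units B) (IsLocalization.map_units B) ?_ ?_
  · intro n c x
    change PHHRing.comparison k A f B n ((1 : B) ⊗ₜ[A] PHHRing.pureTensor k A f n _ *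
      (show B ⊗[A] PHHRing k A f n from x)) = PHHRing.pureTensor k B (algebraMap A B f) n _ *
        PHHRing.comparison k A f B n (show B ⊗[A] PHHRing k A f n from x)
    rw [map_mul, PHHRing.comparison_tmul, map_one, one_mul, PHHRing.map_pureTensor]
    rfl
  · intro n y
    obtain ⟨s, x, hx⟩ := PHHRing.exists_pureTensor_mul_eq_map k A f B S n
      hf.mem_nonZeroDivisors hP hfP y
    refine ⟨s, (1 : B) ⊗ₜ[A] x,
      hx.trans (Eq.trans ?_ (PHHRing.comparison_tmul k A f B n 1 x).symm)⟩
    rw [map_one, one_mul]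
  · intro n x hx
    exact PHHRing.exists_comparison_eq_zero k A f B S n x hx
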